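/- \textbf{Definitions.} Let $K$ be a convex compact subset of a real topological vector space, and let $\mathrm{extr}(K)$ be the set of its extreme points. A \emph{WF-pair} for $K$ consists of (a) a convex set $Y\subsetneq K$ which is a $G_\delta$-subset of $K$ and contains $\mathrm{extr}(K)$; and (b) a lower semicontinuous multivalued map $R:K\to K$ with convex values (lower semicontinuous means that $\{x\in K: R(x)\cap U\neq\emptyset\}$ is open in $K$ for every open $U\subseteq K$) such that $R(x)\cap \mathrm{extr}(K)\ne\emptyset$ for every $x\in K$, and $R(\mathrm{conv}\,A):=\bigcup_{x\in \mathrm{conv} A}R(x)=\mathrm{conv}\,A$ for every finite $A\subseteq \mathrm{extr}(K)$. $K$ has the \emph{Weizsäcker–Filippov property} (WF-property) if a WF-pair for $K$ exists. For $p\in K$ the \emph{convex complement} of $p$ in $K$ is the set of all $m\in K\setminus\{p\}$ such that the infinite ray from $m$ through $p$ meets $K$ exactly in the segment $[m,p]$. Let $P[0,1]$ be the space of Borel probability measures on $[0,1]$ with the topology of weak convergence. \textbf{Theorem.} (1) $P[0,1]$ has the WF-property. In detail: the map $m\mapsto\big(f\mapsto\int f\,dm\big)$ is an affine topological embedding of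 $P[0,1]$ into the dual of $C[0,1]$ with the weak-* topology, and its image is convex, compact and has the WF-property. More generally, the image $K$ of any affine topological embedding of $P[0,1]$ into a real topological vector space is convex, compact and has the WF-property; if $K$ is identified with $P[0,1]$ and $\mu\in P[0,1]$ is any measure absolutely continuous with respect to Lebesgue measure (for example Lebesgue measure itself), then the convex complement $Y$ of $\mu$ in $K$ and the map $R(m)=\{m'\in P[0,1] : \mathrm{supp}\, m'\subseteq \mathrm{supp}\, m\}$ form a WF-pair for $K$. (2) Every infinite-dimensional real Banach space contains a convex compact subset with the WF-property, namely the image of $P[0,1]$ under an affine topological embedding. -/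

import Mathlib

open MeasureTheory Set
open scoped unitInterval NNReal

noncomputable section

/-- `(Y, R)` is a pair of witnesses for the Weizsäcker–Filippov property of `K`: `Y` is a proper
convex subset of `K`, a `G_δ` in `K`, which contains all extreme points of `K`, and `R` is a lower
semicontinuous convex-valued multivalued map `K → K` each of whose values contains an extreme
point of `K` and with `R(conv A) = ⋃_{x ∈ conv A} R(x) = conv A` for each finite set `A` of extreme
points. Only the values of `R` on `K` are relevant. -/
structure IsWFPair {B : Type*} [AddCommGroup B] [Module ℝ B] [TopologicalSpace B]
    (K Y : Set B) (R : B → Set B) : Prop where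
  ssubset : Y ⊂ K
  convex : Convex ℝ Y
  isGδ : IsGδ ((↑) ⁻¹' Y : Set K)
  extremePoints_subset : K.extremePoints ℝ ⊆ Y
  map_subset : ∀ x ∈ K, R x ⊆ K
  map_convex : ∀ x ∈ K, Convex ℝ (R x)
  lowerSemicontinuous : LowerHemicontinuousOn R K
  inter_extremePoints_nonempty : ∀ x ∈ K, (R x ∩ K.extremePoints ℝ).Nonempty
  map_convexHull : ∀ A : Set B, A.Finite → A ⊆ K.extremePoints ℝ →
    ⋃ x ∈ convexHull ℝ A, R x = convexHull ℝ A

/-- The Weizsäcker–Filippov property of a convex compact set `K` in a topological vector space. -/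
def HasWFProperty {B : Type*} [AddCommGroup B] [Module ℝ B] [TopologicalSpace B]
    (K : Set B) : Prop :=
  Convex ℝ K ∧ IsCompact K ∧ ∃ (Y : Set B) (R : B → Set B), IsWFPair K Y R

/-- The convex complement of `p` in `K`: the points `m ∈ K \ {p}` such that the infinite ray from
`m` through `p` meets `K` exactly in the segment `[m, p]`. -/
def convexComplement {B : Type*} [AddCommGroup B] [Module ℝ B] (K : Set B) (p : B) : Set B :=
  {m | m ∈ K \ {p} ∧ {x | ∃ t : ℝ, 0 ≤ t ∧ x = m + t • (p - m)} ∩ K = segment ℝ m p}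

/-- An affine topological embedding of the space `P[0,1]` of Borel probability measures on `[0,1]`
(with the topology of weak convergence) into a topological vector space. -/
structure IsAffineEmbedding {B : Type*} [AddCommGroup B] [Module ℝ B] [TopologicalSpace B]
    (ι : ProbabilityMeasure I → B) : Prop where
  isEmbedding : Topology.IsEmbedding ι
  affine : ∀ (a b : ℝ≥0) (m₁ m₂ m : ProbabilityMeasure I), a + b = 1 →
    (m : Measure I) = a • (m₁ : Measure I) + b • (m₂ : Measure I) →
    ι m = (a : ℝ) • ι m₁ + (b : ℝ) • ι m₂

/-- The multivalued map `R(m) = {m' : supp m' ⊆ supp m}` of `P[0,1]`, read on the image of an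
injective map `ι` of `P[0,1]` into `B`. -/
def supportMap {B : Type*} (ι : ProbabilityMeasure I → B) (x : B) : Set B :=
  {y | ∃ m m' : ProbabilityMeasure I, ι m = x ∧ ι m' = y ∧
    (m' : Measure I).support ⊆ (m : Measure I).support}

/-- A probability measure `m` on `[0,1]` as the functional `f ↦ ∫ f dm`, an element of the dual of
`C[0,1]` with the weak-* topology. -/
def probToWeakDual (m : ProbabilityMeasure I) : WeakDual ℝ C(I, ℝ) :=
  StrongDual.toWeakDual <| LinearMap.mkContinuous
    { toFun := fun f : C(I, ℝ) => ∫ x, f x ∂(m : Measure I)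
      map_add' := fun f g => integral_add
        (f.continuous.integrable_of_hasCompactSupport (.of_compactSpace _))
        (g.continuous.integrable_of_hasCompactSupport (.of_compactSpace _))
      map_smul' := fun c f => integral_const_mul c _ } 1 fun f => by
    have h := norm_integral_le_of_norm_le_const (μ := (m : Measure I)) (f := fun x => f x)
      (C := ‖f‖) (.of_forall fun x => f.norm_coe_le_norm x)
    simpa using h

theorem probToWeakDual_apply (m : ProbabilityMeasure I) (f : C(I, ℝ)) :
    probToWeakDual m f = ∫ x, f x ∂(m : Measure I) := rfl

end

/-! Everything reduces to measures, since `ι` transports convexity and topology. For `m ≠ μ`, the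
ray from `m` through `μ` stays in P[0,1] beyond `μ` exactly when `m ≤ C μ` for some constant `C`
(`mem_convexComplement_iff`): the excess `C μ - m`, normalised, is a point beyond `μ`. So Y consists
of the measures dominated by no multiple of `μ`. It is convex because domination of a mixture passes
to its components, a G_δ because each set `{m ≤ n μ}` is closed, and it contains the extreme points,
the Dirac measures, because `μ` has no atoms.

For R, the convex hull of the Dirac measures on a finite set F is the set of measures carried by F,
which is stable under shrinking supports. Lower semicontinuity holds because, for `m` near `m₀`, the
support of `m` comes close to every point of supp `m₀`; a measure `m'` with support in supp `m₀` is
pushed into supp `m` by a measurable map that moves points of supp `m₀` only slightly.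

In a Banach space, P[0,1] is embedded by its moments, used as coefficients of a rapidly convergent
series along a triangular system. -/

open Filter
open scoped Topology ENNReal

namespace MeasureTheory

/-! ### Mixtures and conditioning -/

section Mixture

variable {X : Type*} [MeasurableSpace X]

/-- The convex combination `a m₁ + b m₂` of two probability measures. -/
noncomputable def ProbabilityMeasure.mix (a b : ℝ≥0) (hab : a + b = 1)
    (m₁ m₂ : ProbabilityMeasure X) : ProbabilityMeasure X :=
  ⟨a • (m₁ : Measure X) + b • (m₂ : Measure X), ⟨by
    rw [Measure.add_apply, Measure.smul_apply, Measure.smul_apply, measure_univ, measure_univ,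
      ENNReal.smul_def, ENNReal.smul_def, smul_eq_mul, smul_eq_mul, mul_one, mul_one]
    exact_mod_cast hab⟩⟩

theorem ProbabilityMeasure.coe_mix (a b : ℝ≥0) (hab : a + b = 1) (m₁ m₂ : ProbabilityMeasure X) :
    (ProbabilityMeasure.mix a b hab m₁ m₂ : Measure X) =
      a • (m₁ : Measure X) + b • (m₂ : Measure X) := rfl

theorem ProbabilityMeasure.mix_apply (a b : ℝ≥0) (hab : a + b = 1)
    (m₁ m₂ : ProbabilityMeasure X) (s : Set X) :
    (ProbabilityMeasure.mix a b hab m₁ m₂ : Measure X) s =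
      a * (m₁ : Measure X) s + b * (m₂ : Measure X) s := by
  rw [coe_mix, Measure.add_apply, Measure.smul_apply, Measure.smul_apply, ENNReal.smul_def,
    ENNReal.smul_def, smul_eq_mul, smul_eq_mul]

/-- A probability measure is a mixture of its conditional measures on a set of intermediate
measure and on its complement. -/
theorem ProbabilityMeasure.exists_eq_mix_cond (m : ProbabilityMeasure X) {s : Set X}
    (hs : MeasurableSet s) (h₀ : (m : Measure X) s ≠ 0) (h₁ : (m : Measure X) sᶜ ≠ 0) :
    ∃ (a b : ℝ≥0) (hab : a + b = 1) (m₁ m₂ : ProbabilityMeasure X), 0 < a ∧ 0 < b ∧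
      m = .mix a b hab m₁ m₂ ∧ (m₁ : Measure X) = ProbabilityTheory.cond m s ∧
      (m₂ : Measure X) = ProbabilityTheory.cond m sᶜ := by
  have ha := ENNReal.coe_toNNReal (measure_ne_top (m : Measure X) s)
  have hb := ENNReal.coe_toNNReal (measure_ne_top (m : Measure X) sᶜ)
  refine ⟨((m : Measure X) s).toNNReal, ((m : Measure X) sᶜ).toNNReal, ?_,
    ⟨_, ProbabilityTheory.cond_isProbabilityMeasure h₀⟩,
    ⟨_, ProbabilityTheory.cond_isProbabilityMeasure h₁⟩, ?_, ?_, ?_, rfl, rfl⟩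
  · rw [← ENNReal.coe_inj, ENNReal.coe_add, ha, hb, prob_add_prob_compl hs, ENNReal.coe_one]
  · exact ENNReal.toNNReal_pos h₀ (measure_ne_top _ _)
  · exact ENNReal.toNNReal_pos h₁ (measure_ne_top _ _)
  · apply Subtype.ext
    ext t ht
    refine Eq.trans ?_ (mix_apply _ _ _ _ _ t).symm
    change (m : Measure X) t = _ * ProbabilityTheory.cond _ _ _ + _ * ProbabilityTheory.cond _ _ _
    rw [ha, hb, ProbabilityTheory.cond_apply hs, ProbabilityTheory.cond_apply hs.compl, ← mul_assoc,
      ← mul_assoc, ENNReal.mul_inv_cancel h₀ (measure_ne_top _ _),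
      ENNReal.mul_inv_cancel h₁ (measure_ne_top _ _), one_mul, one_mul, inter_comm s,
      inter_comm sᶜ, ← sdiff_eq, measure_inter_add_sdiff _ hs]

theorem ProbabilityMeasure.eq_diracProba_of_compl_singleton [MeasurableSingletonClass X]
    (m : ProbabilityMeasure X) {x : X} (h : (m : Measure X) {x}ᶜ = 0) : m = diracProba x := by
  apply Subtype.ext
  change (m : Measure X) = Measure.dirac x
  have hx : (m : Measure X) {x} = 1 := by
    rw [← prob_compl_eq_zero_iff (measurableSet_singleton x)]; exact h
  rw [← Measure.restrict_eq_self_of_ae_mem (μ := (m : Measure X)) (s := {x}) h,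
    Measure.restrict_singleton, hx, one_smul]

end Mixture

/-! ### Supports and Dirac measures -/

section Support

variable {X : Type*} [TopologicalSpace X] [MeasurableSpace X]

theorem Measure.support_nnreal_smul_subset (a : ℝ≥0) (μ : Measure X) :
    (a • μ).support ⊆ μ.support :=
  (Measure.smul_absolutelyContinuous (c := (a : ℝ≥0∞))).support_mono

theorem ProbabilityMeasure.support_mix_subset (a b : ℝ≥0) (hab : a + b = 1)
    (m₁ m₂ : ProbabilityMeasure X) :
    (ProbabilityMeasure.mix a b hab m₁ m₂ : Measure X).support ⊆
      (m₁ : Measure X).support ∪ (m₂ : Measure X).support := by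
  rw [ProbabilityMeasure.coe_mix, Measure.support_add]
  exact union_subset_union (Measure.support_nnreal_smul_subset _ _)
    (Measure.support_nnreal_smul_subset _ _)

theorem support_diracProba_subset [T1Space X] [OpensMeasurableSpace X] (x : X) :
    (diracProba x : Measure X).support ⊆ {x} := by
  apply Measure.support_subset_of_isClosed isClosed_singleton
  change ∀ᵐ y ∂(Measure.dirac x), y ∈ ({x} : Set X)
  exact (ae_dirac_iff (p := (· ∈ ({x} : Set X))) isClosed_singleton.measurableSet).2 rfl

/-- A probability measure taking only the values `0` and `1` on open sets is a Dirac measure. -/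
theorem ProbabilityMeasure.exists_eq_diracProba [T2Space X] [HereditarilyLindelofSpace X]
    [OpensMeasurableSpace X] (m : ProbabilityMeasure X)
    (h : ∀ U : Set X, IsOpen U → (m : Measure X) U = 0 ∨ (m : Measure X) Uᶜ = 0) :
    ∃ x, m = diracProba x := by
  obtain ⟨x, hx⟩ := Measure.nonempty_support (IsProbabilityMeasure.ne_zero (m : Measure X))
  refine ⟨x, m.eq_diracProba_of_compl_singleton ?_⟩
  refine measure_mono_null (compl_subset_compl.2 fun y hy ↦ ?_)
    (Measure.measure_compl_support (μ := (m : Measure X)))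
  -- Two distinct support points have disjoint neighbourhoods, both of positive measure, against the
  -- 0-1 hypothesis.
  by_contra hne
  obtain ⟨U, V, hU, hV, hxU, hyV, hUV⟩ := t2_separation (Ne.symm hne)
  have hU0 := (Measure.mem_support_iff_forall x).1 hx U (hU.mem_nhds hxU)
  have hV0 := (Measure.mem_support_iff_forall y).1 hy V (hV.mem_nhds hyV)
  rcases h U hU with h' | h'
  · exact hU0.ne' h'
  · exact hV0.ne' (measure_mono_null hUV.subset_compl_left h')

end Support

/-! ### Domination of measures -/

section Order

variable {X : Type*} [TopologicalSpace X] [MeasurableSpace X] [BorelSpace X]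
  [TopologicalSpace.PseudoMetrizableSpace X]

/-- Domination of finite measures can be tested on continuous functions. -/
theorem Measure.le_of_forall_lintegral_le {μ ν : Measure X} [IsFiniteMeasure μ] [IsFiniteMeasure ν]
    (h : ∀ f : C(X, ℝ≥0), ∫⁻ x, f x ∂μ ≤ ∫⁻ x, f x ∂ν) : μ ≤ ν := by
  refine Measure.le_iff.2 fun s hs ↦ ?_
  -- Inner regularity reduces to closed sets, whose indicators are limits of continuous functions
  -- from above.
  rw [hs.measure_eq_iSup_isClosed_of_ne_top (measure_ne_top _ _)]
  refine iSup₂_le fun F hFs ↦ iSup_le fun hF ↦ le_trans ?_ (measure_mono hFs)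
  refine ge_of_tendsto (HasOuterApproxClosed.tendsto_lintegral_apprSeq hF ν)
    (.of_forall fun n ↦ ?_)
  exact (HasOuterApproxClosed.measure_le_lintegral hF μ n).trans
    (h (hF.apprSeq n).toContinuousMap)

theorem ProbabilityMeasure.isClosed_setOf_le [CompactSpace X] (ν : Measure X)
    [IsFiniteMeasure ν] : IsClosed {m : ProbabilityMeasure X | (m : Measure X) ≤ ν} := by
  have : {m : ProbabilityMeasure X | (m : Measure X) ≤ ν} =
      ⋂ f : C(X, ℝ≥0), {m : ProbabilityMeasure X | ∫⁻ x, f x ∂(m : Measure X) ≤ ∫⁻ x, f x ∂ν} := by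
    ext m
    simp only [mem_ofPred_eq, mem_iInter]
    exact ⟨fun h f ↦ lintegral_mono' h le_rfl, Measure.le_of_forall_lintegral_le⟩
  rw [this]
  exact isClosed_iInter fun f ↦
    isClosed_le (ProbabilityMeasure.continuous_lintegral_continuousMap f) continuous_const

end Order

/-! ### Pushing measures into nearby supports -/

section Approximation

variable {X : Type*} [MetricSpace X] [MeasurableSpace X] [BorelSpace X]

theorem SimpleFunc.exists_forall_dist_lt [CompactSpace X] [Nonempty X] {ε : ℝ} (hε : 0 < ε) :
    ∃ g : SimpleFunc X X, ∀ z, dist (g z) z < ε := by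
  obtain ⟨t, ht⟩ := isCompact_univ.elim_finite_subcover
    (fun n : ℕ ↦ Metric.ball (TopologicalSpace.denseSeq X n) ε) (fun _ ↦ Metric.isOpen_ball)
    (fun z _ ↦ by
      obtain ⟨n, hn⟩ := (TopologicalSpace.denseRange_denseSeq X).exists_dist_lt z hε
      exact mem_iUnion.2 ⟨n, hn⟩)
  refine ⟨SimpleFunc.nearestPt (TopologicalSpace.denseSeq X) (t.sup id), fun z ↦ ?_⟩
  obtain ⟨n, hn, hz⟩ := mem_iUnion₂.1 (ht (mem_univ z))
  have h := SimpleFunc.edist_nearestPt_le (TopologicalSpace.denseSeq X) z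
    (Finset.le_sup (f := id) hn)
  rw [edist_dist, edist_dist, ENNReal.ofReal_le_ofReal_iff dist_nonneg] at h
  exact h.trans_lt (by rwa [dist_comm])

theorem ProbabilityMeasure.eventually_measure_pos {m₀ : ProbabilityMeasure X} {U : Set X}
    (hU : IsOpen U) (h : 0 < (m₀ : Measure X) U) : ∀ᶠ m : ProbabilityMeasure X in 𝓝 m₀, 0 < (m : Measure X) U :=
  eventually_lt_of_lt_liminf (h.trans_le
    (ProbabilityMeasure.le_liminf_measure_open_of_tendsto (L := 𝓝 m₀) tendsto_id hU))

/-- Measures near `m₀` have support points near all support points of `m₀`, uniformly. -/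
theorem ProbabilityMeasure.eventually_exists_simpleFunc_support [CompactSpace X] [Nonempty X]
    (m₀ : ProbabilityMeasure X) {ε : ℝ} (hε : 0 < ε) :
    ∀ᶠ m : ProbabilityMeasure X in 𝓝 m₀, ∃ h : SimpleFunc X X, (∀ z, h z ∈ (m : Measure X).support) ∧
      ∀ z ∈ (m₀ : Measure X).support, dist (h z) z < ε := by
  obtain ⟨g, hg⟩ := SimpleFunc.exists_forall_dist_lt (X := X) (half_pos hε)
  -- Finitely many balls suffice, as `g` has finite range, and each open ball keeps positive mass
  -- near `m₀`.
  have key : ∀ᶠ m : ProbabilityMeasure X in 𝓝 m₀, ∀ c ∈ g.range, 0 < (m₀ : Measure X) (Metric.ball c (ε / 2)) →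
      0 < (m : Measure X) (Metric.ball c (ε / 2)) := by
    rw [Filter.eventually_all_finset]
    intro c _
    by_cases hc : 0 < (m₀ : Measure X) (Metric.ball c (ε / 2))
    · exact (eventually_measure_pos Metric.isOpen_ball hc).mono fun m hm _ ↦ hm
    · exact .of_forall fun m h ↦ absurd h hc
  filter_upwards [key] with m hm
  -- Where no close point is available, any support point serves, so that `g.map y` always takes
  -- values in supp `m`.
  have hy : ∀ c, ∃ y ∈ (m : Measure X).support, c ∈ g.range →
      0 < (m₀ : Measure X) (Metric.ball c (ε / 2)) → dist y c < ε / 2 := by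
    intro c
    by_cases hc : c ∈ g.range ∧ 0 < (m₀ : Measure X) (Metric.ball c (ε / 2))
    · obtain ⟨y, hy, hy'⟩ := Measure.nonempty_inter_support_of_pos (hm c hc.1 hc.2)
      exact ⟨y, hy', fun _ _ ↦ hy⟩
    · obtain ⟨y, hy⟩ := Measure.nonempty_support (IsProbabilityMeasure.ne_zero (m : Measure X))
      exact ⟨y, hy, fun h₁ h₂ ↦ absurd ⟨h₁, h₂⟩ hc⟩
  choose y hy hy' using hy
  refine ⟨g.map y, fun z ↦ hy _, fun z hz ↦ ?_⟩
  have hpos := (Measure.mem_support_iff_forall z).1 hz _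
    (Metric.isOpen_ball.mem_nhds (show z ∈ Metric.ball (g z) (ε / 2) by
      rw [Metric.mem_ball, dist_comm]; exact hg z))
  calc dist (g.map y z) z ≤ dist (y (g z)) (g z) + dist (g z) z := dist_triangle _ _ _
    _ < ε / 2 + ε / 2 := add_lt_add (hy' _ (SimpleFunc.mem_range_self g z) hpos) (hg z)
    _ = ε := add_halves ε

/-- Dominated convergence, applied to each bounded continuous test function. -/
theorem ProbabilityMeasure.tendsto_map_of_ae_tendsto (m : ProbabilityMeasure X) {h : ℕ → X → X}
    (hm : ∀ n, Measurable (h n))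
    (hlim : ∀ᵐ z ∂(m : Measure X), Tendsto (fun n ↦ h n z) atTop (𝓝 z)) :
    Tendsto (fun n ↦ m.map (hm n).aemeasurable) atTop (𝓝 m) := by
  rw [ProbabilityMeasure.tendsto_iff_forall_integral_tendsto]
  intro f
  have : ∀ n, ∫ x, f x ∂(m.map (hm n).aemeasurable : Measure X) = ∫ x, f (h n x) ∂(m : Measure X) :=
    fun n ↦ by
      rw [ProbabilityMeasure.toMeasure_map, integral_map (hm n).aemeasurable
        f.continuous.measurable.aestronglyMeasurable]
  simp_rw [this]
  refine tendsto_integral_of_dominated_convergence (fun _ ↦ ‖f‖)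
    (fun n ↦ (f.continuous.measurable.comp (hm n)).aestronglyMeasurable)
    (integrable_const _) (fun n ↦ .of_forall fun x ↦ f.norm_coe_le_norm _) ?_
  filter_upwards [hlim] with z hz
  exact (f.continuous.tendsto z).comp hz

/-- The multivalued map `m ↦ {m' : supp m' ⊆ supp m}` is lower hemicontinuous. -/
theorem ProbabilityMeasure.eventually_exists_support_subset [CompactSpace X] [Nonempty X]
    {m₀ m' : ProbabilityMeasure X} (hsupp : (m' : Measure X).support ⊆ (m₀ : Measure X).support)
    {U : Set (ProbabilityMeasure X)} (hU : U ∈ 𝓝 m') :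
    ∀ᶠ m : ProbabilityMeasure X in 𝓝 m₀, ∃ m'' : ProbabilityMeasure X, m'' ∈ U ∧
      (m'' : Measure X).support ⊆ (m : Measure X).support := by
  by_contra hcon
  -- If the claim fails, there are bad `m` arbitrarily near `m₀`. Pushing `m'` into their supports
  -- gives measures outside `U` that nevertheless converge to `m'`.
  have hex : ∀ n : ℕ, ∃ h : SimpleFunc X X,
      m'.map h.measurable.aemeasurable ∉ U ∧
      ∀ z ∈ (m₀ : Measure X).support, dist (h z) z < 1 / ((n : ℝ) + 1) := by
    intro n
    obtain ⟨m, hm, h, hmem, hdist⟩ := ((not_eventually.1 hcon).and_eventually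
      (m₀.eventually_exists_simpleFunc_support (Nat.one_div_pos_of_nat (n := n)))).exists
    refine ⟨h, fun hU' ↦ hm ⟨_, hU', ?_⟩, hdist⟩
    refine Measure.support_subset_of_isClosed Measure.isClosed_support ?_
    rw [ProbabilityMeasure.toMeasure_map, mem_ae_map_iff h.measurable.aemeasurable
      Measure.isClosed_support.measurableSet]
    exact Filter.Eventually.of_forall hmem
  choose h hnU hdist using hex
  have hlim := m'.tendsto_map_of_ae_tendsto (fun n ↦ (h n).measurable) (by
    filter_upwards [Measure.support_mem_ae (μ := (m' : Measure X))] with z hz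
    rw [tendsto_iff_dist_tendsto_zero]
    exact squeeze_zero (fun _ ↦ dist_nonneg) (fun n ↦ (hdist n z (hsupp hz)).le)
      tendsto_one_div_add_atTop_nhds_zero_nat)
  obtain ⟨n, hn⟩ := (hlim.eventually hU).exists
  exact hnU n hn

end Approximation

end MeasureTheory

/-! ### Affine copies of P[0,1] and their WF-pairs -/

namespace IsAffineEmbedding

variable {B : Type*} [AddCommGroup B] [Module ℝ B] [TopologicalSpace B]
  {ι : ProbabilityMeasure I → B}

theorem map_mix (h : IsAffineEmbedding ι) (a b : ℝ≥0) (hab : a + b = 1)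
    (m₁ m₂ : ProbabilityMeasure I) :
    ι (.mix a b hab m₁ m₂) = (a : ℝ) • ι m₁ + (b : ℝ) • ι m₂ :=
  h.affine a b m₁ m₂ _ hab rfl

/-- Real coefficients of a convex combination in the image come from nonnegative ones. -/
theorem exists_mix (h : IsAffineEmbedding ι) {a b : ℝ} (ha : 0 ≤ a) (hb : 0 ≤ b)
    (hab : a + b = 1) (m₁ m₂ : ProbabilityMeasure I) :
    ∃ hab' : a.toNNReal + b.toNNReal = 1,
      ι (.mix a.toNNReal b.toNNReal hab' m₁ m₂) = a • ι m₁ + b • ι m₂ := by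
  have hab' : a.toNNReal + b.toNNReal = 1 := by
    rw [← Real.toNNReal_add ha hb, hab, Real.toNNReal_one]
  refine ⟨hab', ?_⟩
  rw [h.map_mix, Real.coe_toNNReal _ ha, Real.coe_toNNReal _ hb]

theorem convex_image (h : IsAffineEmbedding ι) {S : Set (ProbabilityMeasure I)}
    (hS : ∀ m₁ ∈ S, ∀ m₂ ∈ S, ∀ (a b : ℝ≥0) (hab : a + b = 1),
      ProbabilityMeasure.mix a b hab m₁ m₂ ∈ S) : Convex ℝ (ι '' S) := by
  rintro _ ⟨m₁, hm₁, rfl⟩ _ ⟨m₂, hm₂, rfl⟩ a b ha hb hab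
  obtain ⟨hab', he⟩ := h.exists_mix ha hb hab m₁ m₂
  exact ⟨_, hS _ hm₁ _ hm₂ _ _ hab', he⟩

theorem convex_range (h : IsAffineEmbedding ι) : Convex ℝ (range ι) := by
  rw [← image_univ]
  exact h.convex_image fun _ _ _ _ _ _ _ ↦ mem_univ _

theorem isCompact_range (h : IsAffineEmbedding ι) : IsCompact (range ι) :=
  _root_.isCompact_range h.isEmbedding.continuous

/-- The extreme points of the space of probability measures are the Dirac measures. -/
theorem extremePoints_range (h : IsAffineEmbedding ι) :
    (range ι).extremePoints ℝ = range fun x ↦ ι (diracProba x) := by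
  refine Subset.antisymm ?_ ?_
  · intro y hy
    obtain ⟨⟨m, rfl⟩, hext⟩ := mem_extremePoints_iff_left.1 hy
    suffices ∃ x, m = diracProba x by
      obtain ⟨x, rfl⟩ := this
      exact ⟨x, rfl⟩
    refine m.exists_eq_diracProba fun U hU ↦ ?_
    by_contra! hne
    obtain ⟨a, b, hab, m₁, m₂, ha, hb, hm, hm₁, -⟩ :=
      m.exists_eq_mix_cond hU.measurableSet hne.1 hne.2
    -- Extremality forces `m` to equal its conditional measure on `U`, which vanishes on `Uᶜ`.
    have heq := hext (ι m₁) ⟨m₁, rfl⟩ (ι m₂) ⟨m₂, rfl⟩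
      ⟨a, b, by exact_mod_cast ha, by exact_mod_cast hb, by exact_mod_cast hab, by
        rw [← h.map_mix a b hab, ← hm]⟩
    refine hne.2 ?_
    rw [← h.isEmbedding.injective heq, hm₁, ProbabilityTheory.cond_apply hU.measurableSet]
    simp
  · rintro _ ⟨x, rfl⟩
    refine mem_extremePoints_iff_left.2 ⟨⟨_, rfl⟩, ?_⟩
    rintro _ ⟨m₁, rfl⟩ _ ⟨m₂, rfl⟩ ⟨a, b, ha, hb, hab, he⟩
    obtain ⟨hab', he'⟩ := h.exists_mix ha.le hb.le hab m₁ m₂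
    have heq := h.isEmbedding.injective (he'.trans he)
    have hx : (diracProba x : Measure I) {x}ᶜ = 0 := by
      change Measure.dirac x {x}ᶜ = 0
      simp
    rw [← heq, ProbabilityMeasure.mix_apply, add_eq_zero, mul_eq_zero] at hx
    rcases hx.1 with h0 | h0
    · simp only [ENNReal.coe_eq_zero, Real.toNNReal_eq_zero] at h0
      exact absurd h0 (not_le.2 ha)
    · rw [m₁.eq_diracProba_of_compl_singleton h0]

/-- The convex hull of finitely many Dirac measures. -/
theorem mem_convexHull_diracProba_iff (h : IsAffineEmbedding ι) (F : Finset I)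
    (m : ProbabilityMeasure I) :
    ι m ∈ convexHull ℝ ((fun x ↦ ι (diracProba x)) '' F) ↔ (m : Measure I) (F : Set I)ᶜ = 0 := by
  constructor
  · intro hm
    have hsub : convexHull ℝ ((fun x ↦ ι (diracProba x)) '' F) ⊆
        ι '' {m | (m : Measure I) (F : Set I)ᶜ = 0} := by
      refine convexHull_min ?_ (h.convex_image ?_)
      · rintro _ ⟨x, hx, rfl⟩
        refine ⟨_, ?_, rfl⟩
        change Measure.dirac x _ = 0
        rw [Measure.dirac_apply' _ F.measurableSet.compl]
        simpa using hx
      · intro m₁ hm₁ m₂ hm₂ a b hab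
        rw [mem_ofPred_eq] at hm₁ hm₂ ⊢
        rw [ProbabilityMeasure.mix_apply, hm₁, hm₂, mul_zero, mul_zero, add_zero]
    obtain ⟨m', hm', he⟩ := hsub hm
    rwa [← h.isEmbedding.injective he]
  · induction F using Finset.induction_on generalizing m with
    | empty => intro hm; simp at hm
    | insert x F hx ih =>
      intro hm
      have hmono : convexHull ℝ ((fun x ↦ ι (diracProba x)) '' F) ⊆
          convexHull ℝ ((fun x ↦ ι (diracProba x)) '' (insert x F : Finset I)) :=
        convexHull_mono (image_mono (by simp))
      have hdirac : ι (diracProba x) ∈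
          convexHull ℝ ((fun x ↦ ι (diracProba x)) '' (insert x F : Finset I)) :=
        subset_convexHull _ _ ⟨x, by simp, rfl⟩
      -- Splitting off the atom at `x` by conditioning needs both `{x}` and its complement to have
      -- positive mass.
      by_cases h₁ : (m : Measure I) {x}ᶜ = 0
      · rwa [m.eq_diracProba_of_compl_singleton h₁]
      by_cases h₀ : (m : Measure I) {x} = 0
      · refine hmono (ih m (measure_mono_null (t := {x} ∪ (insert x F : Finset I)ᶜ) ?_
          (measure_union_null h₀ hm)))
        intro y hy
        by_cases hyx : y = x <;> simp_all
      obtain ⟨a, b, hab, m₁, m₂, -, -, he, hm₁, hm₂⟩ :=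
        m.exists_eq_mix_cond (measurableSet_singleton x) h₀ h₁
      have hm₁' : m₁ = diracProba x := by
        refine m₁.eq_diracProba_of_compl_singleton ?_
        rw [hm₁, ProbabilityTheory.cond_apply (measurableSet_singleton x)]
        simp
      have hm₂' : ι m₂ ∈ convexHull ℝ ((fun x ↦ ι (diracProba x)) '' F) := by
        refine ih m₂ ?_
        have hF : (m : Measure I) ({x}ᶜ ∩ (F : Set I)ᶜ) = 0 :=
          measure_mono_null (fun y hy ↦ by simp_all) hm
        rw [hm₂, ProbabilityTheory.cond_apply (measurableSet_singleton x).compl, hF, mul_zero]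
      rw [he, h.map_mix, hm₁']
      exact convex_convexHull ℝ _ hdirac (hmono hm₂') a.2 b.2 (by exact_mod_cast hab)

/-- `m` lies in the convex complement of `μ` iff it is not dominated by a multiple of `μ`. -/
theorem mem_convexComplement_iff (h : IsAffineEmbedding ι) (m μ : ProbabilityMeasure I) :
    ι m ∈ convexComplement (range ι) (ι μ) ↔
      ∀ C : ℝ≥0, ¬ (m : Measure I) ≤ C • (μ : Measure I) := by
  constructor
  · rintro ⟨⟨-, hne⟩, hray⟩ C hC
    -- Enlarging `C` by 2 gives the difference the positive mass `C + 1`. Normalised, it is the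
    -- point of the ray with parameter `(C + 2) / (C + 1) > 1`.
    have hle : (m : Measure I) ≤ (C + 2) • (μ : Measure I) :=
      hC.trans (by rw [add_smul]; exact Measure.le_add_right le_rfl)
    have hsub := Measure.sub_add_cancel_of_le hle
    have hmass : ((C + 2) • (μ : Measure I) - m) univ = (C + 1 : ℝ≥0) := by
      have := congrArg (fun ν : Measure I ↦ ν univ) hsub
      change _ + (m : Measure I) univ = (C + 2 : ℝ≥0) * (μ : Measure I) univ at this
      rw [measure_univ, measure_univ, mul_one] at this
      refine (ENNReal.add_left_inj ENNReal.one_ne_top).1 (this.trans ?_)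
      push_cast
      rw [add_assoc, one_add_one_eq_two]
    have hC1 : C + 1 ≠ 0 := by positivity
    have hC2 : C + 2 ≠ 0 := by positivity
    obtain ⟨ν, hν⟩ : ∃ ν : ProbabilityMeasure I, (ν : Measure I) =
        (C + 1)⁻¹ • ((C + 2) • (μ : Measure I) - m) := by
      refine ⟨⟨_, ⟨?_⟩⟩, rfl⟩
      rw [Measure.smul_apply, hmass, ENNReal.smul_def, smul_eq_mul, ← ENNReal.coe_mul,
        inv_mul_cancel₀ hC1, ENNReal.coe_one]
    have hcoef : (C + 2)⁻¹ * (C + 1) + (C + 2)⁻¹ = 1 := by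
      field_simp
      ring
    have haff := h.affine _ _ ν m μ hcoef (by
      rw [hν, smul_smul, mul_assoc, mul_inv_cancel₀ hC1, mul_one, ← smul_add, hsub, smul_smul,
        inv_mul_cancel₀ hC2, one_smul])
    have hc : (0 : ℝ) ≤ C := C.2
    have hν' : ι ν = ι m + (((C : ℝ) + 2) / (C + 1)) • (ι μ - ι m) := by
      rw [haff]
      push_cast
      match_scalars
      all_goals field_simp
      ring
    obtain ⟨s, ⟨hs0, hs1⟩, hs⟩ : ι ν ∈ (fun s : ℝ ↦ ι m + s • (ι μ - ι m)) '' Icc 0 1 := by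
      rw [← segment_eq_image', ← hray]
      exact ⟨⟨_, by positivity, hν'⟩, ⟨ν, rfl⟩⟩
    have hzero : ((((C : ℝ) + 2) / (C + 1)) - s) • (ι μ - ι m) = 0 := by
      rw [sub_smul, sub_eq_zero]
      exact add_left_cancel (hν'.symm.trans hs.symm)
    rcases smul_eq_zero.1 hzero with h0 | h0
    · have : 1 < ((C : ℝ) + 2) / (C + 1) := by
        rw [one_lt_div (by positivity)]; linarith
      linarith
    · exact hne (sub_eq_zero.1 h0).symm
  · intro hC
    refine ⟨⟨⟨m, rfl⟩, fun heq ↦ hC 1 ?_⟩, Subset.antisymm ?_ ?_⟩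
    · rw [h.isEmbedding.injective heq, one_smul]
    · rintro x ⟨⟨t, ht, hx⟩, ⟨ν, rfl⟩⟩
      rw [segment_eq_image']
      refine ⟨t, ⟨ht, ?_⟩, hx.symm⟩
      by_contra! ht1
      have ht0 : 0 < t := one_pos.trans ht1
      have hb : 0 < 1 - t⁻¹ := sub_pos.2 (inv_lt_one_of_one_lt₀ ht1)
      -- A point `ν` beyond `μ` makes `μ` a mixture of `ν` and `m` with weight `1 - t⁻¹ > 0` on `m`,
      -- so a multiple of `μ` dominates `m`.
      obtain ⟨hab, he⟩ := h.exists_mix (inv_nonneg.2 ht) hb.le (add_sub_cancel _ _) ν m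
      have hμ : (μ : Measure I) = _ := congrArg _ (h.isEmbedding.injective (he.trans (show _ = ι μ by
        rw [hx]
        match_scalars
        all_goals field_simp
        ring))).symm
      rw [ProbabilityMeasure.coe_mix] at hμ
      have hb' : (1 - t⁻¹).toNNReal ≠ 0 := (Real.toNNReal_pos.2 hb).ne'
      refine hC (1 - t⁻¹).toNNReal⁻¹ ?_
      rw [hμ, smul_add, smul_smul _ (1 - t⁻¹).toNNReal, inv_mul_cancel₀ hb', one_smul]
      exact Measure.le_add_left le_rfl
    · refine subset_inter ?_ (h.convex_range.segment_subset ⟨m, rfl⟩ ⟨μ, rfl⟩)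
      rw [segment_eq_image']
      rintro _ ⟨t, ht, rfl⟩
      exact ⟨t, ht.1, rfl⟩

theorem mem_supportMap_iff (h : IsAffineEmbedding ι) (m m' : ProbabilityMeasure I) :
    ι m' ∈ supportMap ι (ι m) ↔ (m' : Measure I).support ⊆ (m : Measure I).support := by
  constructor
  · rintro ⟨n, n', hn, hn', hsub⟩
    rwa [← h.isEmbedding.injective hn, ← h.isEmbedding.injective hn']
  · exact fun hsub ↦ ⟨m, m', rfl, rfl, hsub⟩

theorem supportMap_eq_image (h : IsAffineEmbedding ι) (m : ProbabilityMeasure I) :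
    supportMap ι (ι m) =
      ι '' {m' : ProbabilityMeasure I | (m' : Measure I).support ⊆ (m : Measure I).support} := by
  ext y
  constructor
  · rintro ⟨n, n', hn, hn', hsub⟩
    rw [h.isEmbedding.injective hn] at hsub
    exact ⟨n', hsub, hn'⟩
  · rintro ⟨m', hm', rfl⟩
    exact (h.mem_supportMap_iff m m').2 hm'

theorem lowerHemicontinuousOn_supportMap (h : IsAffineEmbedding ι) :
    LowerHemicontinuousOn (supportMap ι) (range ι) := by
  rw [lowerHemicontinuousOn_iff]
  rintro _ ⟨m₀, rfl⟩
  rw [lowerHemicontinuousWithinAt_iff]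
  rintro U hU ⟨y, hy, hyU⟩
  rw [h.supportMap_eq_image] at hy
  obtain ⟨m', hm', rfl⟩ := hy
  rw [← h.isEmbedding.map_nhds_eq, eventually_map]
  filter_upwards [ProbabilityMeasure.eventually_exists_support_subset hm'
    ((hU.preimage h.isEmbedding.continuous).mem_nhds hyU)] with m ⟨m'', hU', hsub⟩
  exact ⟨ι m'', (h.mem_supportMap_iff m m'').2 hsub, hU'⟩

/-- A finite set is closed, so a measure carried by it has its support inside it, and so do all
members of R at that measure. -/
theorem iUnion_supportMap_convexHull (h : IsAffineEmbedding ι) {A : Set B} (hA : A.Finite)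
    (hsub : A ⊆ (range ι).extremePoints ℝ) :
    ⋃ x ∈ convexHull ℝ A, supportMap ι x = convexHull ℝ A := by
  rw [h.extremePoints_range] at hsub
  obtain ⟨F, hF⟩ : ∃ F : Finset I, A = (fun x ↦ ι (diracProba x)) '' F := by
    have hinj : Function.Injective fun x : I ↦ ι (diracProba x) :=
      h.isEmbedding.injective.comp injective_diracProba
    refine ⟨(hA.preimage hinj.injOn).toFinset, ?_⟩
    rw [Finite.coe_toFinset, image_preimage_eq_of_subset hsub]
  subst hF
  have hrange : convexHull ℝ ((fun x ↦ ι (diracProba x)) '' F) ⊆ range ι :=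
    convexHull_min (by rintro _ ⟨x, -, rfl⟩; exact ⟨_, rfl⟩) h.convex_range
  refine Subset.antisymm (iUnion₂_subset fun x hx ↦ ?_) fun x hx ↦ ?_
  · obtain ⟨m, rfl⟩ := hrange hx
    rw [h.supportMap_eq_image]
    rintro _ ⟨m', hm', rfl⟩
    rw [h.mem_convexHull_diracProba_iff] at hx ⊢
    have hF : (m : Measure I).support ⊆ F :=
      Measure.support_subset_of_isClosed F.finite_toSet.isClosed hx
    exact measure_mono_null (compl_subset_compl.2 (hm'.trans hF)) Measure.measure_compl_support
  · obtain ⟨m, rfl⟩ := hrange hx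
    exact mem_iUnion₂.2 ⟨ι m, hx, (h.mem_supportMap_iff m m).2 Subset.rfl⟩

/-- Natural numbers suffice as constants, so Y is a countable intersection of complements of closed
sets. -/
theorem isGδ_convexComplement (h : IsAffineEmbedding ι) (μ : ProbabilityMeasure I) :
    IsGδ ((↑) ⁻¹' convexComplement (range ι) (ι μ) : Set (range ι)) := by
  have hG : IsGδ {m : ProbabilityMeasure I | ι m ∈ convexComplement (range ι) (ι μ)} := by
    have : {m : ProbabilityMeasure I | ι m ∈ convexComplement (range ι) (ι μ)} =
        ⋂ n : ℕ, {m : ProbabilityMeasure I | (m : Measure I) ≤ (n : ℝ≥0) • (μ : Measure I)}ᶜ := by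
      ext m
      simp only [mem_ofPred_eq, h.mem_convexComplement_iff, mem_iInter, mem_compl_iff]
      refine ⟨fun hm n ↦ hm n, fun hm C hC ↦ ?_⟩
      obtain ⟨n, hn⟩ := exists_nat_ge C
      refine hm n (hC.trans (Measure.le_iff.2 fun s _ ↦ ?_))
      simp only [Measure.smul_apply]
      gcongr
    rw [this]
    exact .iInter_of_isOpen fun n ↦ (ProbabilityMeasure.isClosed_setOf_le _).isOpen_compl
  have := hG.preimage h.isEmbedding.toHomeomorph.symm.continuous
  convert this using 1
  ext ⟨_, m, rfl⟩
  have : h.isEmbedding.toHomeomorph.symm ⟨ι m, m, rfl⟩ = m :=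
    h.isEmbedding.toHomeomorph.symm_apply_apply m
  simp only [mem_preimage, this, mem_ofPred_eq]

theorem isWFPair (h : IsAffineEmbedding ι) (μ : ProbabilityMeasure I)
    (hμ : (μ : Measure I) ≪ volume) :
    IsWFPair (range ι) (convexComplement (range ι) (ι μ)) (supportMap ι) where
  ssubset := ⟨fun _ hx ↦ hx.1.1, fun hsub ↦ (hsub ⟨μ, rfl⟩).1.2 rfl⟩
  convex := by
    have : convexComplement (range ι) (ι μ) =
        ι '' {m | ∀ C : ℝ≥0, ¬ (m : Measure I) ≤ C • (μ : Measure I)} := by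
      ext x
      constructor
      · intro hx
        obtain ⟨m, rfl⟩ := hx.1.1
        exact ⟨m, (h.mem_convexComplement_iff m μ).1 hx, rfl⟩
      · rintro ⟨m, hm, rfl⟩
        exact (h.mem_convexComplement_iff m μ).2 hm
    rw [this]
    refine h.convex_image fun m₁ hm₁ m₂ hm₂ a b hab C hC ↦ ?_
    rw [ProbabilityMeasure.coe_mix] at hC
    rcases eq_or_ne a 0 with rfl | ha
    · rw [zero_add] at hab
      rw [hab, zero_smul, zero_add, one_smul] at hC
      exact hm₂ C hC
    · refine hm₁ (a⁻¹ * C) ?_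
      have hle : a • (m₁ : Measure I) ≤ C • (μ : Measure I) :=
        (Measure.le_add_right le_rfl).trans hC
      refine Measure.le_iff.2 fun s _ ↦ ?_
      have hs := hle s
      rw [Measure.smul_apply, Measure.smul_apply] at hs
      rw [mul_smul, Measure.smul_apply, Measure.smul_apply]
      calc (m₁ : Measure I) s = a⁻¹ • a • (m₁ : Measure I) s := by
            rw [smul_smul, inv_mul_cancel₀ ha, one_smul]
        _ ≤ _ := by gcongr
  isGδ := h.isGδ_convexComplement μ
  extremePoints_subset := by
    rw [h.extremePoints_range]
    rintro _ ⟨x, rfl⟩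
    refine (h.mem_convexComplement_iff _ μ).2 fun C hC ↦ ?_
    have hx := hC {x}
    -- Lebesgue measure has no atoms, hence neither has `μ`.
    rw [Measure.smul_apply, hμ (measure_singleton x), smul_zero] at hx
    change Measure.dirac x {x} ≤ 0 at hx
    simp at hx
  map_subset := by
    rintro _ - _ ⟨_, m', -, rfl, -⟩
    exact ⟨m', rfl⟩
  map_convex := by
    rintro _ ⟨m, rfl⟩
    rw [h.supportMap_eq_image]
    exact h.convex_image fun m₁ hm₁ m₂ hm₂ a b hab ↦
      (ProbabilityMeasure.support_mix_subset a b hab m₁ m₂).trans (union_subset hm₁ hm₂)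
  lowerSemicontinuous := h.lowerHemicontinuousOn_supportMap
  inter_extremePoints_nonempty := by
    rintro _ ⟨m, rfl⟩
    obtain ⟨x, hx⟩ := Measure.nonempty_support (IsProbabilityMeasure.ne_zero (m : Measure I))
    refine ⟨ι (diracProba x), (h.mem_supportMap_iff _ _).2
      ((support_diracProba_subset x).trans (singleton_subset_iff.2 hx)), ?_⟩
    rw [h.extremePoints_range]
    exact ⟨x, rfl⟩
  map_convexHull := fun _ hA hsub ↦ h.iUnion_supportMap_convexHull hA hsub

theorem hasWFProperty (h : IsAffineEmbedding ι) : HasWFProperty (range ι) :=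
  ⟨h.convex_range, h.isCompact_range, _, _,
    h.isWFPair ⟨volume, inferInstance⟩ Measure.AbsolutelyContinuous.rfl⟩

end IsAffineEmbedding

/-! ### Embeddings into the weak-* dual and into Banach spaces -/

/-- P[0,1] is compact, so a continuous injection into a Hausdorff space is an embedding. -/
theorem IsAffineEmbedding.of_continuous_injective {B : Type*} [AddCommGroup B] [Module ℝ B]
    [TopologicalSpace B] [T2Space B] {ι : ProbabilityMeasure I → B} (hc : Continuous ι)
    (hinj : Function.Injective ι)
    (haff : ∀ (a b : ℝ≥0) (m₁ m₂ m : ProbabilityMeasure I), a + b = 1 →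
      (m : Measure I) = a • (m₁ : Measure I) + b • (m₂ : Measure I) →
      ι m = (a : ℝ) • ι m₁ + (b : ℝ) • ι m₂) : IsAffineEmbedding ι :=
  ⟨(hc.isClosedEmbedding hinj).isEmbedding, haff⟩

theorem integrable_continuousMap (f : C(I, ℝ)) (m : Measure I) [IsFiniteMeasure m] :
    Integrable f m :=
  f.continuous.integrable_of_hasCompactSupport (.of_compactSpace _)

theorem integral_nnreal_smul_add_smul (a b : ℝ≥0) (m₁ m₂ : Measure I) [IsFiniteMeasure m₁]
    [IsFiniteMeasure m₂] (f : C(I, ℝ)) :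
    ∫ x, f x ∂(a • m₁ + b • m₂) = a * ∫ x, f x ∂m₁ + b * ∫ x, f x ∂m₂ := by
  rw [integral_add_measure (integrable_continuousMap f _) (integrable_continuousMap f _),
    integral_smul_nnreal_measure, integral_smul_nnreal_measure]
  rfl

theorem MeasureTheory.ProbabilityMeasure.ext_of_integral_continuousMap
    {m₁ m₂ : ProbabilityMeasure I}
    (h : ∀ f : C(I, ℝ), ∫ x, f x ∂(m₁ : Measure I) = ∫ x, f x ∂(m₂ : Measure I)) : m₁ = m₂ :=
  Subtype.ext (ext_of_forall_integral_eq_of_IsFiniteMeasure (μ := (m₁ : Measure I))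
    (ν := (m₂ : Measure I)) fun f ↦ h f.toContinuousMap)

theorem isAffineEmbedding_probToWeakDual : IsAffineEmbedding probToWeakDual := by
  refine .of_continuous_injective ?_ ?_ ?_
  · exact WeakDual.continuous_of_continuous_eval fun f ↦
      ProbabilityMeasure.continuous_integral_continuousMap f
  · intro m₁ m₂ h
    exact ProbabilityMeasure.ext_of_integral_continuousMap fun f ↦ DFunLike.congr_fun h f
  · intro a b m₁ m₂ m _ hm
    refine DFunLike.ext _ _ fun f ↦ ?_
    change _ = a * probToWeakDual m₁ f + b * probToWeakDual m₂ f
    simp only [probToWeakDual_apply]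
    rw [hm, integral_nnreal_smul_add_smul]

/-- The monomial `t ↦ t ^ n` on the unit interval. -/
def unitInterval.monomial (n : ℕ) : C(I, ℝ) := ⟨fun t ↦ (t : ℝ) ^ n, by fun_prop⟩

/-- Probability measures on the unit interval are determined by their moments. -/
theorem MeasureTheory.ProbabilityMeasure.ext_of_moments {m₁ m₂ : ProbabilityMeasure I}
    (h : ∀ n, ∫ t, unitInterval.monomial n t ∂(m₁ : Measure I) =
      ∫ t, unitInterval.monomial n t ∂(m₂ : Measure I)) : m₁ = m₂ := by
  refine ext_of_integral_continuousMap fun f ↦ ?_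
  have hpoly : ∀ g ∈ polynomialFunctions I, probToWeakDual m₁ g = probToWeakDual m₂ g := by
    intro g hg
    rw [← SetLike.mem_coe, polynomialFunctions_coe] at hg
    obtain ⟨p, rfl⟩ := hg
    induction p using Polynomial.induction_on' with
    | add p q hp hq =>
      rw [map_add, map_add, map_add, hp, hq]
    | monomial n a =>
      have he : Polynomial.toContinuousMapOnAlgHom I (Polynomial.monomial n a) =
          a • unitInterval.monomial n := by
        ext t
        simp [unitInterval.monomial]
      rw [he, map_smul, map_smul]
      congr 1
      exact h n
  -- Weierstrass: agreement on the dense set of polynomials extends by continuity.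
  have hclosed : IsClosed {g : C(I, ℝ) | probToWeakDual m₁ g = probToWeakDual m₂ g} :=
    isClosed_eq (probToWeakDual m₁).continuous (probToWeakDual m₂).continuous
  have hf : f ∈ (polynomialFunctions I).topologicalClosure := by
    rw [polynomialFunctions_closure_eq_top']
    trivial
  exact closure_minimal (s := (polynomialFunctions I : Set C(I, ℝ))) hpoly hclosed hf

/-- An infinite-dimensional normed space contains a sequence of unit vectors with functionals
which form a triangular system. -/
theorem exists_triangular_seq (E : Type*) [NormedAddCommGroup E] [NormedSpace ℝ E]
    (hE : ¬ FiniteDimensional ℝ E) :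
    ∃ (e : ℕ → E) (φ : ℕ → StrongDual ℝ E), (∀ n, ‖e n‖ = 1) ∧ (∀ n, φ n (e n) ≠ 0) ∧
      ∀ m n, m < n → φ m (e n) = 0 := by
  obtain ⟨s, hs, hs'⟩ := exists_seq_of_forall_finset_exists
    (fun x : E × StrongDual ℝ E ↦ ‖x.1‖ = 1 ∧ x.2 x.1 ≠ 0) (fun x y ↦ x.2 y.1 = 0) (by
      intro s _
      let T : E →ₗ[ℝ] (s → ℝ) := LinearMap.pi fun x ↦ (x.1.2 : E →ₗ[ℝ] ℝ)
      -- Finitely many functionals on an infinite-dimensional space have a common nonzero kernel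
      -- vector.
      have hT : ¬ Function.Injective T := fun hinj ↦ hE (FiniteDimensional.of_injective T hinj)
      rw [injective_iff_map_eq_zero] at hT
      push Not at hT
      obtain ⟨v, hv, hv0⟩ := hT
      have hu : (‖v‖⁻¹ • v : E) ≠ 0 := smul_ne_zero (inv_ne_zero (norm_ne_zero_iff.2 hv0)) hv0
      obtain ⟨f, hf⟩ := SeparatingDual.exists_ne_zero (R := ℝ) hu
      refine ⟨(‖v‖⁻¹ • v, f), ⟨norm_smul_inv_norm hv0, hf⟩, fun x hx ↦ ?_⟩
      have : x.2 v = 0 := congrFun hv ⟨x, hx⟩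
      simp [this])
  exact ⟨fun n ↦ (s n).1, fun n ↦ (s n).2, fun n ↦ (hs n).1, fun n ↦ (hs n).2, hs'⟩

/-- Every infinite-dimensional Banach space contains an affine copy of the space of probability
measures on the unit interval. -/
theorem exists_isAffineEmbedding (E : Type*) [NormedAddCommGroup E] [NormedSpace ℝ E]
    [CompleteSpace E] (hE : ¬ FiniteDimensional ℝ E) :
    ∃ ι : ProbabilityMeasure I → E, IsAffineEmbedding ι := by
  obtain ⟨e, φ, hnorm, hdiag, htri⟩ := exists_triangular_seq E hE
  let c : ProbabilityMeasure I → ℕ → ℝ := fun m n ↦ ∫ t, unitInterval.monomial n t ∂(m : Measure I)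
  have hc : ∀ m n, |c m n| ≤ 1 := by
    intro m n
    have := norm_integral_le_of_norm_le_const (μ := (m : Measure I))
      (f := fun t ↦ unitInterval.monomial n t) (C := 1) (.of_forall fun t ↦ by
        rw [Real.norm_eq_abs]
        simpa [unitInterval.monomial, abs_of_nonneg t.2.1] using pow_le_one₀ t.2.1 t.2.2)
    simpa using this
  have hbound : ∀ n m, ‖((1 / 2 : ℝ) ^ n * c m n) • e n‖ ≤ (1 / 2) ^ n := by
    intro n m
    rw [norm_smul, hnorm, mul_one, Real.norm_eq_abs, abs_mul, abs_of_pos (by positivity)]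
    exact mul_le_of_le_one_right (by positivity) (hc m n)
  have hgeom : Summable fun n : ℕ ↦ (1 / 2 : ℝ) ^ n := summable_geometric_two
  have hsum : ∀ m, Summable fun n ↦ ((1 / 2 : ℝ) ^ n * c m n) • e n := fun m ↦
    .of_norm_bounded hgeom fun n ↦ hbound n m
  -- Moments lie in `[-1, 1]`, so the weights `2⁻ⁿ` make the series converge uniformly in `m`.
  refine ⟨fun m ↦ ∑' n, ((1 / 2 : ℝ) ^ n * c m n) • e n, .of_continuous_injective ?_ ?_ ?_⟩
  · exact continuous_tsum (fun n ↦ ((ProbabilityMeasure.continuous_integral_continuousMap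
      (unitInterval.monomial n)).const_mul _).smul continuous_const) hgeom hbound
  · intro m₁ m₂ heq
    refine ProbabilityMeasure.ext_of_moments fun n ↦ ?_
    induction n using Nat.strong_induction_on with
    | _ n ih =>
      -- By triangularity `φ n` kills all terms after the `n`-th; with the earlier moments known, it
      -- recovers the `n`-th.
      have hφ : ∀ m, φ n (∑' k, ((1 / 2 : ℝ) ^ k * c m k) • e k) =
          ∑ k ∈ Finset.range (n + 1), ((1 / 2 : ℝ) ^ k * c m k) * φ n (e k) := by
        intro m
        rw [(φ n).map_tsum (hsum m), tsum_eq_sum (s := Finset.range (n + 1))]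
        · simp
        · intro k hk
          rw [Finset.mem_range, not_lt] at hk
          rw [map_smul, htri n k (by omega), smul_zero]
      have h := congrArg (φ n) heq
      simp only [hφ, Finset.sum_range_succ] at h
      rw [Finset.sum_congr rfl fun k hk ↦ by
        rw [show c m₁ k = c m₂ k from ih k (Finset.mem_range.1 hk)]] at h
      have h' := mul_right_cancel₀ (hdiag n) (add_left_cancel h)
      exact mul_left_cancel₀ (by positivity) h'
  · intro a b m₁ m₂ m _ hm
    rw [← (hsum m₁).tsum_const_smul, ← (hsum m₂).tsum_const_smul,
      ← ((hsum m₁).const_smul _).tsum_add ((hsum m₂).const_smul _)]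
    congr 1
    ext n
    have : c m n = a * c m₁ n + b * c m₂ n := by
      simp only [c]
      rw [hm, integral_nnreal_smul_add_smul]
    rw [this]
    module

/-- (1) `P[0,1]` has the Weizsäcker–Filippov property: as a subset of the weak-* dual of `C[0,1]`,
and likewise under every affine topological embedding into a real topological vector space, where
the convex complement of any absolutely continuous measure (for instance Lebesgue measure) and the
map `R(m) = {m' : supp m' ⊆ supp m}` are witnesses. (2) Every infinite-dimensional Banach space
contains a convex compact set with this property, which is an affine copy of `P[0,1]`. -/
theorem theorem7 :
    (IsAffineEmbedding probToWeakDual ∧ HasWFProperty (Set.range probToWeakDual) ∧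
      ∀ (B : Type*) [AddCommGroup B] [Module ℝ B] [TopologicalSpace B]
        [IsTopologicalAddGroup B] [ContinuousSMul ℝ B]
        (ι : ProbabilityMeasure I → B), IsAffineEmbedding ι →
        HasWFProperty (Set.range ι) ∧
        ∀ μ : ProbabilityMeasure I, (μ : Measure I) ≪ volume →
          IsWFPair (Set.range ι) (convexComplement (Set.range ι) (ι μ)) (supportMap ι)) ∧
    ∀ (E : Type*) [NormedAddCommGroup E] [NormedSpace ℝ E] [CompleteSpace E],
      ¬ FiniteDimensional ℝ E →
      ∃ K : Set E, HasWFProperty K ∧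
        ∃ ι : ProbabilityMeasure I → E, IsAffineEmbedding ι ∧ Set.range ι = K := by
  refine ⟨⟨isAffineEmbedding_probToWeakDual, isAffineEmbedding_probToWeakDual.hasWFProperty, ?_⟩,
    ?_⟩
  · intro B _ _ _ _ _ ι h
    exact ⟨h.hasWFProperty, h.isWFPair⟩
  · intro E _ _ _ hE
    obtain ⟨ι, h⟩ := exists_isAffineEmbedding E hE
    exact ⟨range ι, h.hasWFProperty, ι, h, rfl⟩
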